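/- For $q\in(0,1)$ and $n\ge 1$ let $P_n^q$ be the Mallows distribution on the symmetric group $S_n$, i.e. $P_n^q(\sigma)=q^{\mathrm{inv}(\sigma)}/Z_n(q)$, where $\mathrm{inv}(\sigma)$ is the number of inversions of $\sigma$ and $Z_n(q)=\sum_{\sigma\in S_n}q^{\mathrm{inv}(\sigma)}$ is the normalization constant. For $\tau\in S_3$ let $S_n(\tau)$ be the set of permutations in $S_n$ that avoid the pattern $\tau$. Then for every $q\in(0,1)$ and every $\tau\in\{312,231\}$ the limit $\lim_{n\to\infty}\big(P_n^q(S_n(\tau))\big)^{1/n}$ exists and $$\frac{2q^2(1-q)(1-q^3)}{1-q^4-\sqrt{(1-q^4)^2-4q^2(1-q)(1-q^3)}}<\lim_{n\to\infty}\big(P_n^q(S_n(\tau))\big)^{1/n}<\frac{2q^2(q^2+1)(1-q)}{1-\sqrt{1-4(1-q)q^2(q^2+1)}}.$$ -/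

import Mathlib

open Filter Topology

namespace Mallows

/-- The number of inversions of a permutation. -/
def inv {n : ℕ} (σ : Equiv.Perm (Fin n)) : ℕ :=
  (Finset.univ.filter (fun p : Fin n × Fin n => p.1 < p.2 ∧ σ p.2 < σ p.1)).card

/-- `σ` contains `τ` as a pattern: some subsequence of `σ` (at the positions `f 0 < f 1 < ⋯`)
is ordered in the same way as `τ`. -/
def Contains {m n : ℕ} (τ : Equiv.Perm (Fin m)) (σ : Equiv.Perm (Fin n)) : Prop :=
  ∃ f : Fin m → Fin n, StrictMono f ∧ ∀ j k : Fin m, σ (f j) < σ (f k) ↔ τ j < τ k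

/-- The set of permutations in `S_n` that avoid the pattern `τ`. -/
def avoiding {m : ℕ} (n : ℕ) (τ : Equiv.Perm (Fin m)) : Set (Equiv.Perm (Fin n)) :=
  {σ | ¬ Contains τ σ}

/-- The normalization constant of the Mallows distribution. -/
noncomputable def Z (n : ℕ) (q : ℝ) : ℝ :=
  ∑ σ : Equiv.Perm (Fin n), q ^ inv σ

open Classical in
/-- The probability of the event `A` under the Mallows distribution with parameter `q` on `S_n`,
which gives the permutation `σ` the mass `q ^ inv σ / Z n q`. -/
noncomputable def prob (n : ℕ) (q : ℝ) (A : Set (Equiv.Perm (Fin n))) : ℝ :=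
  ∑ σ ∈ Finset.univ.filter (fun σ => σ ∈ A), q ^ inv σ / Z n q

/-- The permutation with one-line notation `312` (written with the values `0, 1, 2`). -/
def p312 : Equiv.Perm (Fin 3) :=
  ⟨![2, 0, 1], ![1, 2, 0], by decide, by decide⟩

/-- The permutation with one-line notation `231` (written with the values `0, 1, 2`). -/
def p231 : Equiv.Perm (Fin 3) :=
  ⟨![1, 2, 0], ![2, 0, 1], by decide, by decide⟩

/-- The lower bound. -/
noncomputable def LB (q : ℝ) : ℝ :=
  2 * q ^ 2 * (1 - q) * (1 - q ^ 3) /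
    (1 - q ^ 4 - Real.sqrt ((1 - q ^ 4) ^ 2 - 4 * q ^ 2 * (1 - q) * (1 - q ^ 3)))

/-- The upper bound. -/
noncomputable def UB (q : ℝ) : ℝ :=
  2 * q ^ 2 * (q ^ 2 + 1) * (1 - q) /
    (1 - Real.sqrt (1 - 4 * (1 - q) * q ^ 2 * (q ^ 2 + 1)))

end Mallows

namespace Mallows

/-! Let c_n be the sum of q^inv over 231-avoiders (`avoidSum`), so that the probability is c_n /
Z_n. After a first value p, a 231-avoider lists all values below p before all values above it. Hence
c_{n+1} = ∑ q^i c_i c_{n-i} (`avoidSum_succ`), and F(x) = ∑ c_n x^n satisfies F(x) = 1 / (1 - x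
F(qx)), which unfolds to the continued fraction 1/(1 - x/(1 - qx/(1 - q²x/⋯))).

The sequence c is supermultiplicative, so c_n^{1/n} tends to its supremum r (`exists_growth`). Since
Z_n^{1/n} → 1/(1-q) (`tendsto_log_Z`), the limit is (1-q) r. Both bounds have the form (1-q)/z with
z a root of a quadratic, and the task is to compare r z with 1.

Lower bound: while F converges, every denominator of the fraction is positive. Truncating after q³x
gives the quadratic of `LB`, and F(q⁴x) ≥ 1 + q⁴x makes the inequality strict (`le_convergent`).

Upper bound: a positive supersolution of the functional equation along t, qt, q²t, … bounds c_n t^n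
(`sum_avoidSum_le`). Three exact steps over a constant tail give one for some t beyond the root z of
the quadratic of `UB`, so r z < 1 (`lt_UB`).

The pattern 312 reduces to 231 because σ ↦ σ⁻¹ preserves inversions. -/

/-! ### Inversions and the normalization constant. -/

lemma inv_eq_sum {n : ℕ} (σ : Equiv.Perm (Fin n)) :
    inv σ = ∑ i, ∑ j, if i < j ∧ σ j < σ i then 1 else 0 := by
  rw [inv, Finset.card_filter, Fintype.sum_prod_type]

/-- The permutation with first value `p` whose remaining values are ordered as in `e`. -/
def consPerm {n : ℕ} (p : Fin (n + 1)) (e : Equiv.Perm (Fin n)) : Equiv.Perm (Fin (n + 1)) :=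
  (finSuccEquiv n).trans ((Equiv.optionCongr e).trans (finSuccEquiv' p).symm)

@[simp] lemma consPerm_zero {n : ℕ} (p : Fin (n + 1)) (e : Equiv.Perm (Fin n)) :
    consPerm p e 0 = p := by
  simp [consPerm]

@[simp] lemma consPerm_succ {n : ℕ} (p : Fin (n + 1)) (e : Equiv.Perm (Fin n)) (i : Fin n) :
    consPerm p e i.succ = p.succAbove (e i) := by
  simp [consPerm]

lemma consPerm_bijective (n : ℕ) :
    Function.Bijective (fun x : Fin (n + 1) × Equiv.Perm (Fin n) => consPerm x.1 x.2) := by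
  rw [Fintype.bijective_iff_injective_and_card]
  constructor
  · rintro ⟨p, e⟩ ⟨p', e'⟩ h
    have h' : consPerm p e = consPerm p' e' := h
    have hp : p = p' := by simpa using congrArg (fun σ => σ 0) h'
    subst hp
    refine Prod.ext rfl (Equiv.ext fun i => ?_)
    simpa using congrArg (fun σ => σ i.succ) h'
  · simp [Fintype.card_perm, Nat.factorial_succ]

/-- The first entry forms an inversion with each of the p smaller values, and the other inversions
are those of `e`. -/
lemma inv_consPerm {n : ℕ} (p : Fin (n + 1)) (e : Equiv.Perm (Fin n)) :
    inv (consPerm p e) = p + inv e := by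
  have key : ∑ j : Fin n, (if p.succAbove (e j) < p then 1 else 0) = (p : ℕ) := by
    rw [Equiv.sum_comp e (fun j => if p.succAbove j < p then 1 else 0)]
    simp only [Fin.succAbove_lt_iff_castSucc_lt]
    rw [Finset.sum_boole, Nat.cast_id]
    have : (Finset.univ.filter fun j : Fin n => j.castSucc < p).card
        = (Finset.range (p : ℕ)).card := by
      refine Finset.card_bij (fun j _ => (j : ℕ)) ?_ ?_ ?_
      · intro j hj
        simpa [Fin.lt_def] using hj
      · intro a _ b _ h
        exact Fin.ext h
      · intro b hb
        have hb' : b < p := by simpa using hb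
        exact ⟨⟨b, by omega⟩, by simpa [Fin.lt_def] using hb', rfl⟩
    rw [this, Finset.card_range]
  rw [inv_eq_sum, inv_eq_sum, Fin.sum_univ_succ]
  simp only [Fin.sum_univ_succ, consPerm_zero, consPerm_succ, lt_irrefl, false_and, if_false,
    Fin.succ_pos, true_and, Fin.not_lt_zero, zero_add, Fin.succ_lt_succ_iff,
    Fin.succAbove_lt_succAbove_iff, key]

lemma Z_zero (q : ℝ) : Z 0 q = 1 := by
  simp [Z, inv]

lemma Z_succ (n : ℕ) (q : ℝ) : Z (n + 1) q = (∑ i ∈ Finset.range (n + 1), q ^ i) * Z n q := by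
  rw [Z, ← (consPerm_bijective n).sum_comp, Fintype.sum_prod_type, Finset.sum_range, Z,
    Finset.sum_mul]
  refine Finset.sum_congr rfl fun p _ => ?_
  rw [Finset.mul_sum]
  exact Finset.sum_congr rfl fun e _ => by simp only [inv_consPerm, pow_add]

/-! ### Structure of 231-avoiders and the recursion for their generating polynomial. -/

/-- A permutation contains `231` if and only if it has a subsequence `σ i, σ j, σ k` with
`σ k < σ i < σ j`. -/
lemma contains_p231_iff {n : ℕ} (σ : Equiv.Perm (Fin n)) :
    Contains p231 σ ↔ ∃ i j k, i < j ∧ j < k ∧ σ k < σ i ∧ σ i < σ j := by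
  constructor
  · rintro ⟨f, hf, h⟩
    exact ⟨f 0, f 1, f 2, hf (by decide), hf (by decide), (h 2 0).2 (by decide),
      (h 0 1).2 (by decide)⟩
  · rintro ⟨i, j, k, hij, hjk, h1, h2⟩
    refine ⟨![i, j, k], ?_, ?_⟩
    · rw [Fin.strictMono_iff_lt_succ]
      intro a
      fin_cases a
      · exact hij
      · exact hjk
    · have h3 := h1.trans h2
      intro a b
      fin_cases a <;> fin_cases b <;>
        simp [p231, h1, h2, h3, h1.le, h2.le, h3.le]

lemma mem_avoiding_p231 {n : ℕ} (σ : Equiv.Perm (Fin n)) :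
    σ ∈ avoiding n p231 ↔ ∀ i j k, i < j → j < k → σ i < σ j → σ i ≤ σ k := by
  rw [avoiding, Set.mem_ofPred_eq, contains_p231_iff]
  push Not
  constructor
  · intro h i j k hij hjk h1
    by_contra! h2
    exact absurd (h i j k hij hjk h2) (not_le.2 h1)
  · intro h i j k hij hjk h1
    by_contra! h2
    exact absurd (h i j k hij hjk h2) (not_le.2 h1)

/-- A permutation avoids `231` exactly when the values after the first one do and
those smaller than the first value come first. -/
lemma consPerm_mem_avoiding_p231 {n : ℕ} (p : Fin (n + 1)) (e : Equiv.Perm (Fin n)) :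
    consPerm p e ∈ avoiding (n + 1) p231 ↔
      e ∈ avoiding n p231 ∧ ∀ j k, j < k → (e k : ℕ) < p → (e j : ℕ) < p := by
  simp only [mem_avoiding_p231]
  constructor
  · intro h
    refine ⟨fun i j k hij hjk h1 => ?_, fun j k hjk h1 => ?_⟩
    · simpa [h1] using h i.succ j.succ k.succ (by simpa) (by simpa)
    · have := h 0 j.succ k.succ (Fin.succ_pos _) (by simpa)
      simp only [consPerm_zero, consPerm_succ, Fin.lt_succAbove_iff_le_castSucc, Fin.le_def,
        Fin.val_castSucc] at this
      by_contra! h2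
      have h3 := this h2
      have h4 : p.succAbove (e k) = (e k).castSucc :=
        Fin.succAbove_of_castSucc_lt _ _ (by simpa [Fin.lt_def])
      rw [h4, Fin.val_castSucc] at h3
      omega
  · rintro ⟨h, h'⟩ i j k
    induction j using Fin.cases with
    | zero => intro h0; exact absurd h0 (Fin.not_lt_zero _)
    | succ j =>
    induction k using Fin.cases with
    | zero => intro _ h0; exact absurd h0 (Fin.not_lt_zero _)
    | succ k =>
    induction i using Fin.cases with
    | zero =>
      intro _ hjk
      simp only [consPerm_zero, consPerm_succ, Fin.lt_succAbove_iff_le_castSucc]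
      intro h1
      by_contra! h2
      rw [Fin.succAbove_lt_iff_castSucc_lt, Fin.lt_def, Fin.val_castSucc] at h2
      have := h' j k (by simpa using hjk) h2
      rw [Fin.le_def, Fin.val_castSucc] at h1
      omega
    | succ i =>
      intro hij hjk
      simpa using h i j k (by simpa using hij) (by simpa using hjk)

/-- The direct sum of two permutations. -/
def dirSum {k m : ℕ} (a : Equiv.Perm (Fin k)) (b : Equiv.Perm (Fin m)) :
    Equiv.Perm (Fin (k + m)) :=
  finSumFinEquiv.permCongr (Equiv.sumCongr a b)

@[simp] lemma dirSum_castAdd {k m : ℕ} (a : Equiv.Perm (Fin k)) (b : Equiv.Perm (Fin m))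
    (i : Fin k) : dirSum a b (Fin.castAdd m i) = Fin.castAdd m (a i) := by
  simp [dirSum, Equiv.permCongr_apply]

@[simp] lemma dirSum_natAdd {k m : ℕ} (a : Equiv.Perm (Fin k)) (b : Equiv.Perm (Fin m))
    (i : Fin m) : dirSum a b (Fin.natAdd k i) = Fin.natAdd k (b i) := by
  simp [dirSum, Equiv.permCongr_apply]

lemma castAdd_lt_natAdd' {k m : ℕ} (i : Fin k) (j : Fin m) :
    Fin.castAdd m i < Fin.natAdd k j := by
  simp only [Fin.lt_def, Fin.val_castAdd, Fin.val_natAdd]; omega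

lemma castAdd_lt_castAdd' {k m : ℕ} (i j : Fin k) :
    Fin.castAdd m i < Fin.castAdd m j ↔ i < j := Iff.rfl

lemma castAdd_le_castAdd' {k m : ℕ} (i j : Fin k) :
    Fin.castAdd m i ≤ Fin.castAdd m j ↔ i ≤ j := Iff.rfl

lemma inv_dirSum {k m : ℕ} (a : Equiv.Perm (Fin k)) (b : Equiv.Perm (Fin m)) :
    inv (dirSum a b) = inv a + inv b := by
  have h1 (i : Fin k) (j : Fin m) := castAdd_lt_natAdd' i j
  have h2 (i : Fin k) (j : Fin m) := (castAdd_lt_natAdd' i j).not_gt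
  simp only [inv_eq_sum, Fin.sum_univ_add, dirSum_castAdd, dirSum_natAdd, h1, h2,
    castAdd_lt_castAdd', Fin.natAdd_lt_natAdd_iff, false_and, and_false, if_false,
    Finset.sum_const_zero, add_zero, zero_add]

lemma dirSum_mem_avoiding_p231 {k m : ℕ} (a : Equiv.Perm (Fin k)) (b : Equiv.Perm (Fin m)) :
    dirSum a b ∈ avoiding (k + m) p231 ↔ a ∈ avoiding k p231 ∧ b ∈ avoiding m p231 := by
  simp only [mem_avoiding_p231]
  constructor
  · intro h
    refine ⟨fun i j l hij hjl h1 => ?_, fun i j l hij hjl h1 => ?_⟩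
    · simpa only [dirSum_castAdd, castAdd_lt_castAdd', castAdd_le_castAdd', hij, hjl, h1,
        forall_const] using h (Fin.castAdd m i) (Fin.castAdd m j) (Fin.castAdd m l)
    · simpa [hij, hjl, h1] using h (Fin.natAdd k i) (Fin.natAdd k j) (Fin.natAdd k l)
  · rintro ⟨ha, hb⟩ i j l hij hjl
    induction i using Fin.addCases with
    | left i =>
      induction l using Fin.addCases with
      | left l =>
        induction j using Fin.addCases with
        | left j =>
          rw [castAdd_lt_castAdd'] at hij hjl
          simpa only [dirSum_castAdd, castAdd_lt_castAdd', castAdd_le_castAdd'] using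
            ha i j l hij hjl
        | right j => exact absurd hjl (castAdd_lt_natAdd' _ _).not_gt
      | right l =>
        intro _
        simpa using (castAdd_lt_natAdd' (a i) (b l)).le
    | right i =>
      induction j using Fin.addCases with
      | left j => exact absurd hij (castAdd_lt_natAdd' _ _).not_gt
      | right j =>
        induction l using Fin.addCases with
        | left l => exact absurd hjl (castAdd_lt_natAdd' _ _).not_gt
        | right l => simpa using hb i j l (by simpa using hij) (by simpa using hjl)

lemma dirSum_injective (k m : ℕ) : Function.Injective
    (fun x : Equiv.Perm (Fin k) × Equiv.Perm (Fin m) => dirSum x.1 x.2) := by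
  rintro ⟨a, b⟩ ⟨a', b'⟩ h
  have h' : dirSum a b = dirSum a' b' := h
  refine Prod.ext (Equiv.ext fun i => ?_) (Equiv.ext fun i => ?_)
  · simpa using congrArg (fun σ => σ (Fin.castAdd m i)) h'
  · simpa using congrArg (fun σ => σ (Fin.natAdd k i)) h'

/-- A permutation in which the `k` smallest values come first is a direct sum. -/
lemma exists_dirSum {k m : ℕ} (e : Equiv.Perm (Fin (k + m)))
    (h : ∀ i j, i < j → (e j : ℕ) < k → (e i : ℕ) < k) : ∃ a b, dirSum a b = e := by
  -- If some position `i < k` held a large value, all `k` small values would sit strictly before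
  -- `i`, where there is too little room.
  have hmaps : ∀ i : Fin (k + m), (i : ℕ) < k → (e i : ℕ) < k := by
    intro i hi
    by_contra! hei
    have hsub : (Finset.univ.filter fun j : Fin (k + m) => (e j : ℕ) < k) ⊆ Finset.Iio i := by
      intro j hj
      rw [Finset.mem_Iio]
      by_contra! hij
      have hj' : (e j : ℕ) < k := by simpa using hj
      rcases hij.eq_or_lt with rfl | hlt
      · omega
      · exact absurd (h i j hlt hj') (by omega)
    have hcard := Finset.card_le_card hsub
    have h1 : (Finset.univ.filter fun j : Fin (k + m) => (e j : ℕ) < k).card = k := by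
      have : (Finset.univ.filter fun j : Fin (k + m) => (e j : ℕ) < k)
          = (Finset.univ.filter fun j : Fin (k + m) => (j : ℕ) < k).map e.symm.toEmbedding := by
        ext j
        simp
      rw [this, Finset.card_map]
      simp [Fin.card_filter_val_lt]
    rw [h1, Fin.card_Iio] at hcard
    omega
  let σ : Equiv.Perm (Fin k ⊕ Fin m) := finSumFinEquiv.symm.permCongr e
  have hσ : Set.MapsTo σ (Set.range Sum.inl) (Set.range Sum.inl) := by
    rintro _ ⟨i, rfl⟩
    have h1 : (e (Fin.castAdd m i) : ℕ) < k := hmaps _ (by simp)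
    refine ⟨⟨_, h1⟩, ?_⟩
    simp only [σ, Equiv.permCongr_apply, Equiv.symm_symm, finSumFinEquiv_apply_left]
    rw [Equiv.eq_symm_apply]
    simp
  obtain ⟨⟨a, b⟩, hab⟩ := Equiv.Perm.mem_sumCongrHom_range_of_perm_mapsTo_inl hσ
  refine ⟨a, b, ?_⟩
  have hab' : Equiv.sumCongr a b = σ := hab
  rw [dirSum, hab']
  ext i
  simp [σ, Equiv.permCongr_apply]

open Classical in
/-- The generating polynomial of the inversion number on the permutations avoiding `231`. -/
noncomputable def avoidSum (q : ℝ) (n : ℕ) : ℝ :=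
  ∑ σ : Equiv.Perm (Fin n), if σ ∈ avoiding n p231 then q ^ inv σ else 0

open Classical in
lemma sum_blocks (q : ℝ) {n k m : ℕ} (hn : n = k + m) :
    (∑ e : Equiv.Perm (Fin n), if e ∈ avoiding n p231 ∧
      (∀ i j, i < j → (e j : ℕ) < k → (e i : ℕ) < k) then q ^ inv e else 0)
      = avoidSum q k * avoidSum q m := by
  subst hn
  rw [avoidSum, avoidSum, Finset.sum_mul_sum, ← Fintype.sum_prod_type']
  symm
  refine Finset.sum_of_injOn (fun x => dirSum x.1 x.2) (dirSum_injective k m).injOn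
    (fun _ _ => Finset.mem_coe.2 (Finset.mem_univ _)) ?_ ?_
  · intro e _ he
    rw [if_neg]
    rintro ⟨_, h⟩
    obtain ⟨a, b, rfl⟩ := exists_dirSum e h
    exact he ⟨(a, b), by simp, rfl⟩
  · rintro ⟨a, b⟩ _
    have h : ∀ i j : Fin (k + m), i < j → (dirSum a b j : ℕ) < k → (dirSum a b i : ℕ) < k := by
      intro i j hij
      induction i using Fin.addCases with
      | left i => intro _; simp
      | right i =>
        induction j using Fin.addCases with
        | left j => exact absurd hij (castAdd_lt_natAdd' _ _).not_gt
        | right j => simp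
    simp only [dirSum_mem_avoiding_p231, inv_dirSum, pow_add, and_iff_left h]
    by_cases ha : a ∈ avoiding k p231 <;> by_cases hb : b ∈ avoiding m p231 <;> simp [ha, hb]

lemma avoidSum_zero (q : ℝ) : avoidSum q 0 = 1 := by
  have h : ∀ σ : Equiv.Perm (Fin 0), σ ∈ avoiding 0 p231 := fun σ => by
    rw [mem_avoiding_p231]; exact fun i => i.elim0
  simp [avoidSum, inv, h]

/-- Split by the first value `p`: it contributes q^p, and the rest is a direct sum of avoiders of
sizes `p` and `n - p`. -/
lemma avoidSum_succ (q : ℝ) (n : ℕ) : avoidSum q (n + 1) =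
    ∑ ij ∈ Finset.HasAntidiagonal.antidiagonal n, q ^ ij.1 * avoidSum q ij.1 * avoidSum q ij.2 := by
  classical
  rw [Finset.Nat.sum_antidiagonal_eq_sum_range_succ_mk, Finset.sum_range, avoidSum,
    ← (consPerm_bijective n).sum_comp, Fintype.sum_prod_type]
  refine Finset.sum_congr rfl fun p _ => ?_
  rw [mul_assoc, ← sum_blocks q (show n = p + (n - p) by omega), Finset.mul_sum]
  refine Finset.sum_congr rfl fun e _ => ?_
  rw [mul_ite, mul_zero, ← pow_add, ← inv_consPerm]
  simp only [consPerm_mem_avoiding_p231]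

lemma prob_avoiding_p231 (n : ℕ) (q : ℝ) : prob n q (avoiding n p231) = avoidSum q n / Z n q := by
  classical
  rw [prob, avoidSum, ← Finset.sum_div, Finset.sum_filter]

/-! ### Symmetry under inversion of permutations. -/

lemma inv_inv {n : ℕ} (σ : Equiv.Perm (Fin n)) : inv σ⁻¹ = inv σ := by
  refine Finset.card_bij' (fun x _ => (σ⁻¹ x.2, σ⁻¹ x.1)) (fun x _ => (σ x.2, σ x.1)) ?_ ?_ ?_ ?_
  all_goals simp +contextual

lemma Contains.inv {m n : ℕ} {τ : Equiv.Perm (Fin m)} {σ : Equiv.Perm (Fin n)}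
    (h : Contains τ σ) : Contains τ⁻¹ σ⁻¹ := by
  obtain ⟨f, hf, h⟩ := h
  refine ⟨fun j => σ (f (τ⁻¹ j)), fun a b hab => (h _ _).2 (by simpa using hab), fun j k => ?_⟩
  simpa using hf.lt_iff_lt

lemma prob_avoiding_inv {m n : ℕ} (τ : Equiv.Perm (Fin m)) (q : ℝ) :
    prob n q (avoiding n τ⁻¹) = prob n q (avoiding n τ) := by
  classical
  have h (σ : Equiv.Perm (Fin n)) : σ⁻¹ ∈ avoiding n τ⁻¹ ↔ σ ∈ avoiding n τ :=
    not_congr ⟨fun h => by simpa using h.inv, Contains.inv⟩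
  unfold prob
  refine Finset.sum_bij' (fun σ _ => σ⁻¹) (fun σ _ => σ⁻¹) ?_ ?_ ?_ ?_ ?_
  · intro σ hσ
    simpa [← h] using hσ
  · intro σ hσ
    simpa [h] using hσ
  · simp
  · simp
  · simp [inv_inv]

lemma p312_eq : p312 = p231⁻¹ := by
  ext i
  fin_cases i <;> rfl

/-! ### Growth rates of the weighted counts and of the normalization. -/

variable {q : ℝ}

lemma avoidSum_succ' (q : ℝ) (n : ℕ) : avoidSum q (n + 1) =
    ∑ i ∈ Finset.range (n + 1), q ^ i * avoidSum q i * avoidSum q (n - i) := by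
  rw [avoidSum_succ, Finset.Nat.sum_antidiagonal_eq_sum_range_succ_mk]

lemma avoidSum_nonneg (hq : 0 ≤ q) (n : ℕ) : 0 ≤ avoidSum q n := by
  classical
  exact Finset.sum_nonneg fun σ _ => by split_ifs <;> positivity

lemma one_le_avoidSum (hq : 0 ≤ q) (n : ℕ) : 1 ≤ avoidSum q n := by
  induction n with
  | zero => exact (avoidSum_zero q).ge
  | succ n ih =>
    refine ih.trans ?_
    rw [avoidSum_succ']
    have h := Finset.single_le_sum (s := Finset.range (n + 1))
      (f := fun i => q ^ i * avoidSum q i * avoidSum q (n - i))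
      (fun i _ => mul_nonneg (mul_nonneg (pow_nonneg hq i) (avoidSum_nonneg hq _))
        (avoidSum_nonneg hq _)) (Finset.mem_range.2 n.succ_pos)
    simpa [avoidSum_zero] using h

/-- Supermultiplicativity, by induction: expand both sides by the recursion and discard the terms of
index above `n` in the longer sum. -/
lemma avoidSum_mul_le (hq : 0 ≤ q) (n m : ℕ) :
    avoidSum q n * avoidSum q m ≤ avoidSum q (n + m) := by
  induction n using Nat.strong_induction_on with
  | _ n ih =>
    cases n with
    | zero => simp [avoidSum_zero]
    | succ n =>
      rw [show n + 1 + m = n + m + 1 by omega, avoidSum_succ', avoidSum_succ', Finset.sum_mul]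
      refine le_trans (Finset.sum_le_sum (g := fun i =>
        q ^ i * avoidSum q i * avoidSum q (n + m - i)) fun i hi => ?_)
        (Finset.sum_le_sum_of_subset_of_nonneg (Finset.range_mono (by omega)) fun i _ _ =>
          mul_nonneg (mul_nonneg (pow_nonneg hq i) (avoidSum_nonneg hq _))
            (avoidSum_nonneg hq _))
      have hi' : i < n + 1 := Finset.mem_range.1 hi
      rw [mul_assoc, show n + m - i = n - i + m by omega]
      exact mul_le_mul_of_nonneg_left (ih (n - i) (by omega))
        (mul_nonneg (pow_nonneg hq i) (avoidSum_nonneg hq _))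

/-- The triangle of index pairs lies in the square. This bounds Cauchy products of partial sums
without assuming convergence. -/
lemma sum_antidiagonal_le_mul {f g : ℕ → ℝ} (hf : ∀ n, 0 ≤ f n) (hg : ∀ n, 0 ≤ g n) (N : ℕ) :
    ∑ n ∈ Finset.range N, ∑ ij ∈ Finset.HasAntidiagonal.antidiagonal n, f ij.1 * g ij.2 ≤
      (∑ n ∈ Finset.range N, f n) * ∑ n ∈ Finset.range N, g n := by
  rw [Finset.sum_mul_sum, ← Finset.sum_product', Finset.sum_sigma']
  rw [← Finset.sum_image (f := fun x : ℕ × ℕ => f x.1 * g x.2)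
    (g := fun x : (_ : ℕ) × (ℕ × ℕ) => x.2)]
  · refine Finset.sum_le_sum_of_subset_of_nonneg ?_ fun x _ _ => mul_nonneg (hf _) (hg _)
    intro x hx
    simp only [Finset.mem_image, Finset.mem_sigma, Finset.mem_range,
      Finset.HasAntidiagonal.mem_antidiagonal] at hx
    obtain ⟨⟨n, y⟩, ⟨h1, h2⟩, rfl⟩ := hx
    simp only [Finset.mem_product, Finset.mem_range] at h1 h2 ⊢
    omega
  · rintro ⟨n, y⟩ hx ⟨n', y'⟩ hx' h
    simp only [Finset.coe_sigma, Set.mem_sigma_iff, Finset.mem_coe,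
      Finset.HasAntidiagonal.mem_antidiagonal] at hx hx'
    obtain rfl : y = y' := h
    obtain rfl : n = n' := hx.2.symm.trans hx'.2
    rfl

/-- A positive supersolution of the functional equation `F(z) = 1 + z F(z) F(qz)` along the orbit
`t, qt, q²t, …` bounds the partial sums of the generating function. -/
lemma sum_avoidSum_le (hq : 0 ≤ q) {t : ℝ} (ht : 0 ≤ t) {u : ℕ → ℝ}
    (hu : ∀ k, 0 ≤ u k) (h : ∀ k, 1 + q ^ k * t * u k * u (k + 1) ≤ u k) (N k : ℕ) :
    ∑ n ∈ Finset.range N, avoidSum q n * (q ^ k * t) ^ n ≤ u k := by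
  -- The step for `k` uses the hypothesis at both `k` and `k + 1`.
  induction N generalizing k with
  | zero => simpa using hu k
  | succ N ih =>
    have hc := avoidSum_nonneg hq
    have hw : 0 ≤ q ^ k * t := by positivity
    rw [Finset.sum_range_succ', avoidSum_zero, pow_zero, mul_one]
    have h1 : ∀ n, avoidSum q (n + 1) * (q ^ k * t) ^ (n + 1) = q ^ k * t *
        ∑ ij ∈ Finset.HasAntidiagonal.antidiagonal n,
          (avoidSum q ij.1 * (q ^ (k + 1) * t) ^ ij.1) *
            (avoidSum q ij.2 * (q ^ k * t) ^ ij.2) := by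
      intro n
      rw [avoidSum_succ, Finset.sum_mul, Finset.mul_sum]
      refine Finset.sum_congr rfl fun ij hij => ?_
      rw [← Finset.HasAntidiagonal.mem_antidiagonal.1 hij]
      rw [show q ^ (k + 1) * t = q * (q ^ k * t) by ring, mul_pow q]
      ring
    simp only [h1]
    rw [← Finset.mul_sum]
    have h2 := sum_antidiagonal_le_mul
      (f := fun n => avoidSum q n * (q ^ (k + 1) * t) ^ n)
      (g := fun n => avoidSum q n * (q ^ k * t) ^ n)
      (fun n => mul_nonneg (hc n) (by positivity)) (fun n => mul_nonneg (hc n) (by positivity)) N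
    have h3 := mul_le_mul (ih (k + 1)) (ih k)
      (Finset.sum_nonneg fun n _ => mul_nonneg (hc n) (by positivity)) (hu _)
    have h4 := mul_le_mul_of_nonneg_left (h2.trans h3) hw
    linarith [h k]

lemma avoidSum_mul_pow_le (hq : 0 ≤ q) {t : ℝ} (ht : 0 ≤ t) {u : ℕ → ℝ}
    (hu : ∀ k, 0 ≤ u k) (h : ∀ k, 1 + q ^ k * t * u k * u (k + 1) ≤ u k) (n : ℕ) :
    avoidSum q n * t ^ n ≤ u 0 := by
  have h1 := sum_avoidSum_le hq ht hu h (n + 1) 0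
  rw [pow_zero, one_mul] at h1
  exact (Finset.single_le_sum (f := fun n => avoidSum q n * t ^ n)
    (fun i _ => mul_nonneg (avoidSum_nonneg hq i) (by positivity))
    (Finset.self_mem_range_succ n)).trans h1

/-- The Catalan bound: at t = 1/4 the constant 2 is a supersolution. Fekete's lemma needs this to
have a finite limit. -/
lemma avoidSum_le (hq : 0 ≤ q) (hq1 : q ≤ 1) (n : ℕ) : avoidSum q n ≤ 2 * 4 ^ n := by
  have h := avoidSum_mul_pow_le hq (t := 1 / 4) (by norm_num) (u := fun _ => 2)
    (fun _ => by norm_num) (fun k => by have := pow_le_one₀ (n := k) hq hq1; linarith) n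
  rw [one_div, inv_pow, ← div_eq_mul_inv, div_le_iff₀ (by positivity)] at h
  exact h

lemma subadditive_neg_log_avoidSum (hq : 0 ≤ q) :
    Subadditive fun n => -Real.log (avoidSum q n) := by
  intro m n
  have h1 := one_le_avoidSum hq m
  have h2 := one_le_avoidSum hq n
  have h := Real.log_le_log (by positivity) (avoidSum_mul_le hq m n)
  rw [Real.log_mul (by positivity) (by positivity)] at h
  linarith

lemma bddBelow_neg_log_avoidSum (hq : 0 ≤ q) (hq1 : q ≤ 1) :
    BddBelow (Set.range fun n : ℕ => -Real.log (avoidSum q n) / n) := by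
  refine ⟨-(Real.log 2 + Real.log 4), ?_⟩
  rintro _ ⟨n, rfl⟩
  have l2 := Real.log_nonneg (show (1 : ℝ) ≤ 2 by norm_num)
  have l4 := Real.log_nonneg (show (1 : ℝ) ≤ 4 by norm_num)
  rcases n.eq_zero_or_pos with rfl | hn
  · simp; linarith
  · have h1 := one_le_avoidSum hq n
    have h := Real.log_le_log (by positivity) (avoidSum_le hq hq1 n)
    rw [Real.log_mul (by norm_num) (by positivity), Real.log_pow] at h
    have hn' : (1 : ℝ) ≤ n := by exact_mod_cast hn
    simp only
    rw [le_div_iff₀ (by positivity)]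
    nlinarith

/-- The sequence `avoidSum q` has an exponential growth rate, which bounds every term. -/
lemma exists_growth (hq : 0 ≤ q) (hq1 : q ≤ 1) : ∃ r : ℝ, 0 < r ∧
    Tendsto (fun n : ℕ => Real.log (avoidSum q n) / n) atTop (𝓝 (Real.log r)) ∧
    ∀ n, avoidSum q n ≤ r ^ n := by
  have hb := bddBelow_neg_log_avoidSum hq hq1
  have hs := subadditive_neg_log_avoidSum hq
  refine ⟨Real.exp (-hs.lim), Real.exp_pos _, ?_, fun n => ?_⟩
  · rw [Real.log_exp]
    simpa [neg_div] using (hs.tendsto_lim hb).neg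
  · rcases n.eq_zero_or_pos with rfl | hn
    · simp [avoidSum_zero]
    · have h := hs.lim_le_div hb hn.ne'
      have hn' : (0 : ℝ) < n := by exact_mod_cast hn
      rw [le_div_iff₀ hn'] at h
      rw [← Real.exp_nat_mul, ← Real.log_le_iff_le_exp
        (zero_lt_one.trans_le (one_le_avoidSum hq n))]
      linarith

/-- log Z_n is a sum of logarithms of geometric partial sums, which tend to log (1/(1-q)); the
averages follow by Cesàro. -/
lemma tendsto_log_Z (hq : 0 ≤ q) (hq1 : q < 1) :
    Tendsto (fun n : ℕ => Real.log (Z n q) / n) atTop (𝓝 (-Real.log (1 - q))) := by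
  have hpos : ∀ n, 0 < ∑ i ∈ Finset.range (n + 1), q ^ i := fun n => by
    rw [Finset.sum_range_succ']
    have : 0 ≤ ∑ i ∈ Finset.range n, q ^ (i + 1) := Finset.sum_nonneg fun _ _ => by positivity
    simp only [pow_zero]
    linarith
  have hZ : ∀ n, 0 < Z n q ∧
      Real.log (Z n q) = ∑ j ∈ Finset.range n, Real.log (∑ i ∈ Finset.range (j + 1), q ^ i) := by
    intro n
    induction n with
    | zero => simp [Z_zero]
    | succ n ih =>
      rw [Z_succ]
      refine ⟨mul_pos (hpos n) ih.1, ?_⟩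
      rw [Real.log_mul (hpos n).ne' ih.1.ne', ih.2, add_comm]
      exact (Finset.sum_range_succ _ n).symm
  have h1 : Tendsto (fun n => ∑ i ∈ Finset.range (n + 1), q ^ i) atTop (𝓝 (1 - q)⁻¹) :=
    (tendsto_add_atTop_iff_nat 1).2 (hasSum_geometric_of_lt_one hq hq1).tendsto_sum_nat
  have h2 := (h1.log (inv_ne_zero (sub_pos.2 hq1).ne')).cesaro
  rw [Real.log_inv] at h2
  refine h2.congr fun n => ?_
  rw [(hZ n).2, div_eq_inv_mul]

lemma Z_pos (hq : 0 < q) (n : ℕ) : 0 < Z n q :=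
  Finset.sum_pos (fun _ _ => by positivity) Finset.univ_nonempty

lemma tendsto_prob_avoiding_p231 (hq : 0 < q) (hq1 : q < 1) {r : ℝ} (hr : 0 < r)
    (h : Tendsto (fun n : ℕ => Real.log (avoidSum q n) / n) atTop (𝓝 (Real.log r))) :
    Tendsto (fun n : ℕ => prob n q (avoiding n p231) ^ (1 / (n : ℝ))) atTop
      (𝓝 ((1 - q) * r)) := by
  have h1 := (h.sub (tendsto_log_Z hq.le hq1)).rexp
  rw [sub_neg_eq_add, Real.exp_add, Real.exp_log hr, Real.exp_log (sub_pos.2 hq1),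
    mul_comm] at h1
  refine h1.congr fun n => ?_
  have hc := zero_lt_one.trans_le (one_le_avoidSum hq.le n)
  rw [prob_avoiding_p231, Real.rpow_def_of_pos (div_pos hc (Z_pos hq n)),
    Real.log_div hc.ne' (Z_pos hq n).ne', mul_one_div, sub_div]

/-- The growth rate is at most `1 / t` if `avoidSum q n * t ^ n` is bounded. -/
lemma growth_mul_le_one (hq : 0 ≤ q) {r t K : ℝ} (hr : 0 < r) (ht : 0 < t)
    (h : Tendsto (fun n : ℕ => Real.log (avoidSum q n) / n) atTop (𝓝 (Real.log r)))
    (hK : ∀ n, avoidSum q n * t ^ n ≤ K) : r * t ≤ 1 := by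
  have h1 : Tendsto (fun n : ℕ => Real.log K / n - Real.log t) atTop (𝓝 (0 - Real.log t)) :=
    (tendsto_const_div_atTop_nhds_zero_nat _).sub_const _
  have h2 : Real.log r ≤ 0 - Real.log t := by
    refine le_of_tendsto_of_tendsto h h1 ?_
    filter_upwards [eventually_gt_atTop 0] with n hn
    have hc := zero_lt_one.trans_le (one_le_avoidSum hq n)
    have h3 := Real.log_le_log (by positivity) (hK n)
    rw [Real.log_mul hc.ne' (by positivity), Real.log_pow] at h3
    have hn' : (0 : ℝ) < n := by exact_mod_cast hn
    rw [div_sub' hn'.ne']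
    gcongr
    linarith
  rw [← Real.log_nonpos_iff (by positivity), Real.log_mul hr.ne' ht.ne']
  linarith

/-! ### Lower bound: positivity of the denominators of the continued fraction. -/

/-- The generating function of `avoidSum q`. -/
noncomputable def genFun (q x : ℝ) : ℝ := ∑' n, avoidSum q n * x ^ n

lemma summable_genFun (hq : 0 ≤ q) {r x : ℝ} (hr : 0 < r) (h : ∀ n, avoidSum q n ≤ r ^ n)
    (hx : 0 ≤ x) (hrx : r * x < 1) : Summable fun n => avoidSum q n * x ^ n := by
  refine Summable.of_nonneg_of_le
    (fun n => mul_nonneg (avoidSum_nonneg hq n) (by positivity)) (fun n => ?_)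
    (summable_geometric_of_lt_one (by positivity) hrx)
  rw [mul_pow]
  exact mul_le_mul_of_nonneg_right (h n) (by positivity)

lemma one_add_le_genFun (hq : 0 ≤ q) {r x : ℝ} (hr : 0 < r) (h : ∀ n, avoidSum q n ≤ r ^ n)
    (hx : 0 ≤ x) (hrx : r * x < 1) : 1 + x ≤ genFun q x := by
  have h1 := (summable_genFun hq hr h hx hrx).sum_le_tsum (Finset.range 2)
    (fun n _ => mul_nonneg (avoidSum_nonneg hq n) (by positivity))
  have h2 := one_le_avoidSum hq 1
  rw [Finset.sum_range_succ, Finset.sum_range_one, avoidSum_zero] at h1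
  rw [genFun]
  nlinarith

/-- The functional equation of the generating function. -/
lemma genFun_eq (hq : 0 ≤ q) (hq1 : q ≤ 1) {r x : ℝ} (hr : 0 < r)
    (h : ∀ n, avoidSum q n ≤ r ^ n) (hx : 0 ≤ x) (hrx : r * x < 1) :
    genFun q x * (1 - x * genFun q (q * x)) = 1 := by
  have hqx : q * x ≤ x := mul_le_of_le_one_left hx hq1
  have s1 := summable_genFun hq hr h hx hrx
  have s2 := summable_genFun hq hr h (x := q * x) (by positivity)
    ((mul_le_mul_of_nonneg_left hqx hr.le).trans_lt hrx)
  have h1 := tsum_mul_tsum_eq_tsum_sum_antidiagonal_of_summable_norm s2.norm s1.norm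
  have h2 : genFun q x = 1 + x * (genFun q (q * x) * genFun q x) := by
    rw [genFun, genFun, h1, s1.tsum_eq_zero_add, avoidSum_zero, pow_zero, mul_one, ← tsum_mul_left]
    congr 1
    refine tsum_congr fun n => ?_
    rw [avoidSum_succ, Finset.sum_mul, Finset.mul_sum]
    refine Finset.sum_congr rfl fun ij hij => ?_
    rw [← Finset.HasAntidiagonal.mem_antidiagonal.1 hij, mul_pow q]
    ring
  linarith

/-- The fourth convergent of the continued fraction bounds the radius of convergence. -/
lemma le_convergent (hq : 0 < q) (hq1 : q < 1) {r x : ℝ} (hr : 0 < r)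
    (h : ∀ n, avoidSum q n ≤ r ^ n) (hx : 0 ≤ x) (hrx : r * x < 1)
    (hx1 : (1 + q) * x < 1) :
    q ^ 7 * x ^ 2 * (1 - (1 + q) * x) ≤
      1 - (1 + q + q ^ 2 + q ^ 3) * x + q ^ 2 * (1 + q + q ^ 2) * x ^ 2 := by
  have hk (k : ℕ) : 0 < genFun q (q ^ k * x) ∧ 1 + q ^ k * x ≤ genFun q (q ^ k * x) ∧
      genFun q (q ^ k * x) * (1 - q ^ k * x * genFun q (q ^ (k + 1) * x)) = 1 := by
    have h0 : 0 ≤ q ^ k * x := by positivity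
    have h1 : r * (q ^ k * x) < 1 :=
      (mul_le_mul_of_nonneg_left (mul_le_of_le_one_left hx (pow_le_one₀ hq.le hq1.le))
        hr.le).trans_lt hrx
    have h2 := one_add_le_genFun hq.le hr h h0 h1
    have h3 := genFun_eq hq.le hq1.le hr h h0 h1
    rw [← mul_assoc q, ← pow_succ'] at h3
    exact ⟨by linarith, h2, h3⟩
  obtain ⟨p0, -, e0⟩ := hk 0
  obtain ⟨p1, -, e1⟩ := hk 1
  obtain ⟨p2, -, e2⟩ := hk 2
  obtain ⟨p3, -, e3⟩ := hk 3
  obtain ⟨-, b4, -⟩ := hk 4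
  generalize genFun q (q ^ 0 * x) = F0 at *
  generalize genFun q (q ^ (0 + 1) * x) = F1 at *
  generalize genFun q (q ^ (1 + 1) * x) = F2 at *
  generalize genFun q (q ^ (2 + 1) * x) = F3 at *
  generalize genFun q (q ^ (3 + 1) * x) = F4 at *
  have d0 := pos_of_mul_pos_right (e0 ▸ one_pos) p0.le
  have d1 := pos_of_mul_pos_right (e1 ▸ one_pos) p1.le
  have d2 := pos_of_mul_pos_right (e2 ▸ one_pos) p2.le
  have d3 := pos_of_mul_pos_right (e3 ▸ one_pos) p3.le
  -- Clearing fractions from the inside out: `i2`, `i1`, `i0` give the successive numerators as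
  -- polynomials in `x` and `D`, all positive.
  set D := 1 - q ^ 3 * x * F4 with hD
  have i2 : (1 - q ^ 2 * x * F3) * D = D - q ^ 2 * x := by linear_combination -(q ^ 2 * x) * e3
  have i1 : (1 - q ^ 1 * x * F2) * (D - q ^ 2 * x) = D - q ^ 2 * x - q * x * D := by
    rw [← i2]; linear_combination -(q * x * D) * e2
  have i0 : (1 - q ^ 0 * x * F1) * (D - q ^ 2 * x - q * x * D)
      = D - q ^ 2 * x - q * x * D - x * (D - q ^ 2 * x) := by
    rw [← i1]; linear_combination -(x * (D - q ^ 2 * x)) * e1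
  have m2 := mul_pos d2 d3
  rw [i2] at m2
  have m1 := mul_pos d1 m2
  rw [i1] at m1
  have m0 := mul_pos d0 m1
  rw [i0] at m0
  have hD' : D ≤ 1 - q ^ 3 * x * (1 + q ^ 4 * x) := by
    have := mul_le_mul_of_nonneg_left b4 (show 0 ≤ q ^ 3 * x by positivity)
    linarith
  have := mul_le_mul_of_nonneg_right hD' (sub_nonneg.2 hx1.le)
  linarith

lemma one_lt_growth_mul (hq : 0 < q) (hq1 : q < 1) {r z : ℝ} (hr : 0 < r)
    (h : ∀ n, avoidSum q n ≤ r ^ n) (hz : 0 < z) (hz1 : (1 + q) * z < 1)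
    (hp : 1 - (1 + q + q ^ 2 + q ^ 3) * z + q ^ 2 * (1 + q + q ^ 2) * z ^ 2 = 0) :
    1 < r * z := by
  by_contra! hrz
  have hle : q ^ 7 * z ^ 2 * (1 - (1 + q) * z) ≤
      1 - (1 + q + q ^ 2 + q ^ 3) * z + q ^ 2 * (1 + q + q ^ 2) * z ^ 2 := by
    -- Convergence is known only for x < z, so let x ↑ z; at the root the right side vanishes and
    -- the left does not.
    refine le_of_tendsto_of_tendsto (b := 𝓝[<] z)
      (f := fun x => q ^ 7 * x ^ 2 * (1 - (1 + q) * x))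
      (g := fun x => 1 - (1 + q + q ^ 2 + q ^ 3) * x + q ^ 2 * (1 + q + q ^ 2) * x ^ 2)
      ?_ ?_ ?_
    · exact (Continuous.tendsto (by fun_prop) z).mono_left nhdsWithin_le_nhds
    · exact (Continuous.tendsto (by fun_prop) z).mono_left nhdsWithin_le_nhds
    · filter_upwards [Ioo_mem_nhdsLT hz] with x hx
      exact le_convergent hq hq1 hr h hx.1.le
        ((mul_lt_mul_of_pos_left hx.2 hr).trans_le hrz)
        ((mul_lt_mul_of_pos_left hx.2 (by positivity)).trans hz1)
  have : 0 < q ^ 7 * z ^ 2 * (1 - (1 + q) * z) := mul_pos (by positivity) (sub_pos.2 hz1)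
  linarith

lemma LB_lt (hq : 0 < q) (hq1 : q < 1) {r : ℝ} (hr : 0 < r)
    (h : ∀ n, avoidSum q n ≤ r ^ n) : LB q < (1 - q) * r := by
  have hd : 0 < 1 - q := sub_pos.2 hq1
  have hq2 : 0 < q ^ 2 := by positivity
  have hq3 : 0 < 1 - q ^ 3 := sub_pos.2 (pow_lt_one₀ hq.le hq1 (by norm_num))
  have hq4 : 0 < 1 - q ^ 4 := sub_pos.2 (pow_lt_one₀ hq.le hq1 (by norm_num))
  set E := (1 - q ^ 4) ^ 2 - 4 * q ^ 2 * (1 - q) * (1 - q ^ 3) with hE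
  have hE0 : (1 - q) ^ 2 * ((1 + q) * (1 - q ^ 2 )) ^ 2 < E := by
    have : E - (1 - q) ^ 2 * ((1 + q) * (1 - q ^ 2)) ^ 2 = (1 - q) ^ 2 * (4 * q ^ 3) := by
      rw [hE]; ring
    have h2 : 0 < (1 - q) ^ 2 * (4 * q ^ 3) := by positivity
    linarith
  have hs1 : (1 - q) * ((1 + q) * (1 - q ^ 2)) < √E := by
    apply Real.lt_sqrt_of_sq_lt
    rwa [mul_pow]
  have hE1 : 0 ≤ E := le_trans (by positivity) hE0.le
  have hs2 : √E < 1 - q ^ 4 := by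
    rw [Real.sqrt_lt' hq4]
    have : 0 < 4 * q ^ 2 * (1 - q) * (1 - q ^ 3) := by positivity
    linarith
  have hss := Real.sq_sqrt hE1
  set s := √E with hs
  have hz : 0 < (1 - q ^ 4 - s) / (2 * q ^ 2 * (1 - q ^ 3)) :=
    div_pos (sub_pos.2 hs2) (by positivity)
  have key := one_lt_growth_mul hq hq1 hr h hz ?_ ?_
  · rw [LB, ← hE, ← hs, div_lt_iff₀ (sub_pos.2 hs2)]
    rw [mul_div_assoc', one_lt_div (by positivity)] at key
    have := mul_lt_mul_of_pos_left key hd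
    linarith
  · rw [mul_div_assoc', div_lt_one (by positivity)]
    nlinarith [mul_lt_mul_of_pos_left hs1 (show 0 < 1 + q by positivity)]
  · have h3 : 1 - q ^ 3 ≠ 0 := hq3.ne'
    have h1 : 1 - q ≠ 0 := hd.ne'
    set z := (1 - q ^ 4 - s) / (2 * q ^ 2 * (1 - q ^ 3)) with hzdef
    have hz1 : s = 1 - q ^ 4 - z * (2 * q ^ 2 * (1 - q ^ 3)) := by
      rw [hzdef]; field_simp; ring
    have h4 : (4 * q ^ 2 * (1 - q ^ 3) * (1 - q)) *
        (1 - (1 + q + q ^ 2 + q ^ 3) * z + q ^ 2 * (1 + q + q ^ 2) * z ^ 2) = 0 := by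
      rw [hz1, hE] at hss
      linear_combination hss
    exact (mul_eq_zero.1 h4).resolve_left (by positivity)

/-! ### Upper bound: a supersolution with constant tail. -/

/-- A truncation of the continued fraction whose tail is bounded by a constant gives an upper bound
for the growth rate. -/
lemma growth_mul_le_one_of_convergent (hq : 0 < q) (hq1 : q < 1) {r t : ℝ} (hr : 0 < r)
    (h : Tendsto (fun n : ℕ => Real.log (avoidSum q n) / n) atTop (𝓝 (Real.log r)))
    (ht : 0 < t) (ht1 : t < 1) (hw : 4 * (q ^ 3 * t) < 1)
    (hG : 0 < (1 - t) * (1 - 3 * (q ^ 3 * t) - q ^ 2 * t * (1 - 2 * (q ^ 3 * t)))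
      - q * t * (1 - 3 * (q ^ 3 * t))) : r * t ≤ 1 := by
  set w := q ^ 3 * t with hwdef
  have hw0 : 0 < w := by positivity
  have hw3 : 0 < 1 - 3 * w := by linarith
  -- This is 1/(1 - w/(1 - 2w)): two steps of the Catalan fraction with tail 2, the value of the
  -- Catalan series at w = 1/4.
  set c := (1 - 2 * w) / (1 - 3 * w) with hc
  have hc0 : 0 < c := div_pos (by linarith) hw3
  have hcw : 1 + w * c * c ≤ c := by
    have : c - (1 + w * c * c) = w ^ 2 * (1 - 4 * w) / (1 - 3 * w) ^ 2 := by
      have hne : 1 - w * 3 ≠ 0 := by rw [mul_comm w]; exact hw3.ne'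
      rw [hc]; field_simp; ring
    have h2 : 0 ≤ w ^ 2 * (1 - 4 * w) / (1 - 3 * w) ^ 2 :=
      div_nonneg (mul_nonneg (by positivity) (by linarith)) (by positivity)
    linarith
  have ht1' : 0 < 1 - t := sub_pos.2 ht1
  have h2 : q * t < (1 - t) * (1 - q ^ 2 * t * c) := by
    have e : (1 - t) * (1 - q ^ 2 * t * c) - q * t =
        ((1 - t) * (1 - 3 * w - q ^ 2 * t * (1 - 2 * w)) - q * t * (1 - 3 * w)) / (1 - 3 * w) := by
      have hne : 1 - w * 3 ≠ 0 := by rw [mul_comm w]; exact hw3.ne'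
      rw [hc]; field_simp
    have := div_pos hG hw3
    linarith
  have hd2 : 0 < 1 - q ^ 2 * t * c :=
    pos_of_mul_pos_right ((by positivity : 0 < q * t).trans h2) ht1'.le
  set u2 := (1 - q ^ 2 * t * c)⁻¹ with hu2
  have hu2p : 0 < u2 := inv_pos.2 hd2
  have e2 : u2 * (1 - q ^ 2 * t * c) = 1 := inv_mul_cancel₀ hd2.ne'
  have h1 : q * t * u2 < 1 - t := by
    have := mul_lt_mul_of_pos_right h2 hu2p
    rwa [mul_assoc (1 - t), mul_comm _ u2, mul_comm _ u2, e2, mul_one, mul_comm u2] at this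
  have hd1 : t < 1 - q * t * u2 := by linarith
  set u1 := (1 - q * t * u2)⁻¹ with hu1
  have hu1p : 0 < u1 := inv_pos.2 (ht.trans hd1)
  have e1 : u1 * (1 - q * t * u2) = 1 := inv_mul_cancel₀ (ht.trans hd1).ne'
  have hd0 : 0 < 1 - t * u1 := by
    have := mul_lt_mul_of_pos_left hd1 hu1p
    linarith
  set u0 := (1 - t * u1)⁻¹ with hu0
  have hu0p : 0 < u0 := inv_pos.2 hd0
  have e0 : u0 * (1 - t * u1) = 1 := inv_mul_cancel₀ hd0.ne'
  let u : ℕ → ℝ := fun k => match k with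
    | 0 => u0
    | 1 => u1
    | 2 => u2
    | _ + 3 => c
  refine growth_mul_le_one hq.le hr ht h (avoidSum_mul_pow_le hq.le ht.le (u := u) ?_ ?_)
  · rintro (_ | _ | _ | k)
    exacts [hu0p.le, hu1p.le, hu2p.le, hc0.le]
  · rintro (_ | _ | _ | k)
    · change 1 + q ^ 0 * t * u0 * u1 ≤ u0
      linarith
    · change 1 + q ^ 1 * t * u1 * u2 ≤ u1
      linarith
    · change 1 + q ^ 2 * t * u2 * c ≤ u2
      linarith
    · change 1 + q ^ (k + 3) * t * c * c ≤ c
      have h3 : q ^ (k + 3) * t ≤ w := by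
        rw [pow_add, mul_assoc]
        exact mul_le_of_le_one_left hw0.le (pow_le_one₀ hq.le hq1.le)
      have := mul_le_mul_of_nonneg_right h3 (mul_pos hc0 hc0).le
      linarith

lemma pow_three_mul_one_sub_lt (q : ℝ) : 8 * (q ^ 3 * (1 - q)) < 1 := by
  nlinarith [sq_nonneg (q ^ 2 - q * (3 / 4)), sq_nonneg (q - 3 / 4), sq_nonneg (q ^ 2 - 9 / 16),
    sq_nonneg q]

lemma four_mul_lt_one (hq : 0 < q) (hq1 : q < 1) : 4 * ((1 - q) * q ^ 2 * (q ^ 2 + 1)) < 1 := by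
  nlinarith [sq_nonneg (q ^ 2 - q * (3 / 4)), sq_nonneg (q - 3 / 4), sq_nonneg (q ^ 2 - 9 / 16),
    sq_nonneg q]

/-- The polynomial inequality behind the upper bound. -/
lemma convergent_pos (hq : 0 < q) (hq1 : q < 1) {z : ℝ} (hz : 0 < z) (hz2 : z < 2 * (1 - q))
    (hv : 2 * (q ^ 2 * (q ^ 2 + 1)) * z < 1)
    (hQ : (1 - q) - z + q ^ 2 * (q ^ 2 + 1) * z ^ 2 = 0) :
    0 < (1 - z) * (1 - 3 * (q ^ 3 * z) - q ^ 2 * z * (1 - 2 * (q ^ 3 * z)))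
      - q * z * (1 - 3 * (q ^ 3 * z)) := by
  -- Up to positive factors, `A + B * z` is the target reduced modulo the quadratic `hQ`.
  set A := -1 - q + 3 * q ^ 2 + q ^ 3 + 2 * q ^ 4 with hA
  set B := 1 + 2 * q - 2 * q ^ 2 - 3 * q ^ 3 - 3 * q ^ 4 - 3 * q ^ 5 with hB
  suffices hAB : 0 < A + B * z by
    have e : (q ^ 2 + 1) ^ 2 * ((1 - z) * (1 - 3 * (q ^ 3 * z) - q ^ 2 * z * (1 - 2 * (q ^ 3 * z)))
      - q * z * (1 - 3 * (q ^ 3 * z))) = q ^ 2 * (A + B * z) := by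
      rw [hA, hB]
      linear_combination (1 + q + 4 * q ^ 2 + 5 * q ^ 3 + 3 * q ^ 4 + 2 * q ^ 5 -
        (2 * q ^ 3 + 2 * q ^ 5) * z) * hQ
    have h1 : 0 < q ^ 2 * (A + B * z) := by positivity
    rw [← e] at h1
    exact pos_of_mul_pos_right h1 (by positivity)
  rcases le_total (61 / 100) q with hq6 | hq6
  · have hA0 : 0 < A := by
      nlinarith [pow_le_pow_left₀ (by norm_num) hq6 2, pow_le_pow_left₀ (by norm_num) hq6 3,
        pow_le_pow_left₀ (by norm_num) hq6 4]
    have hAB2 : 0 < A + B * (2 * (1 - q)) := by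
      have hd := sub_nonneg.2 hq6
      have he := sub_nonneg.2 hq1.le
      -- Bernstein-type products, nonnegative on [61/100, 1], certify the polynomial inequality.
      have b (i j : ℕ) := mul_nonneg (pow_nonneg hd i) (pow_nonneg he j)
      linarith [b 0 6, b 1 5, b 2 4, b 3 3, b 4 2, b 5 1, b 6 0]
    rcases le_total 0 B with h0 | h0
    · positivity
    · nlinarith
  · have he := sub_nonneg.2 hq6
    have b (i j : ℕ) := mul_nonneg (pow_nonneg hq.le i) (pow_nonneg he j)
    have hB0 : 0 < B := by
      linarith [b 0 5, b 1 4, b 2 3, b 3 2, b 4 1, b 5 0]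
    have hle : 0 ≤ A + B := by
      linarith [b 1 4, b 2 3, b 3 2, b 4 1, b 5 0]
    -- This is B² times the quadratic at -A/B. If A + Bz ≤ 0, then -A/B would lie in [z, 1], between
    -- the two roots, where the quadratic is nonpositive.
    have hN : 0 < (1 - q) * B ^ 2 + A * B + q ^ 2 * (q ^ 2 + 1) * A ^ 2 := by
      have e : (1 - q) * B ^ 2 + A * B + q ^ 2 * (q ^ 2 + 1) * A ^ 2 = q ^ 5 *
        (1 - 3 * q ^ 2 + 4 * q ^ 3 - 9 * q ^ 4 + 8 * q ^ 5 - 5 * q ^ 6 + 4 * q ^ 7) := by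
        rw [hA, hB]; ring
      rw [e]
      refine mul_pos (by positivity) ?_
      linarith [b 0 7, b 1 6, b 2 5, b 3 4, b 4 3, b 5 2, b 6 1, b 7 0]
    by_contra! hneg
    set m := q ^ 2 * (q ^ 2 + 1) with hm
    have hz1 : z ≤ 1 := le_of_mul_le_mul_left (by linarith) hB0
    have hmq : m ≤ q := by
      have : q * (q ^ 2 + 1) ≤ 1 := by nlinarith [pow_le_pow_left₀ hq.le hq6 2]
      rw [hm]; nlinarith
    -- The other root 1/m - z is at least 1: by `hQ`, (1 - z)(1 - m(1 + z)) = q - m.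
    have hm1 : m * (1 + z) ≤ 1 := by
      rcases hz1.eq_or_lt with rfl | hlt
      · linarith
      · by_contra! hgt
        nlinarith [mul_pos (sub_pos.2 hlt) (sub_pos.2 hgt)]
    have hm0 : 0 < m := by positivity
    have e : (1 - q) * B ^ 2 + A * B + m * A ^ 2 = (-A - B * z) * (m * (-A + B * z) - B) := by
      linear_combination B ^ 2 * hQ
    have h1 : m * (-A + B * z) ≤ B := by
      have := mul_le_mul_of_nonneg_left (show -A + B * z ≤ B + B * z by linarith) hm0.le
      linarith [mul_le_mul_of_nonneg_left hm1 hB0.le]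
    rw [e] at hN
    exact hN.not_ge (mul_nonpos_of_nonneg_of_nonpos (by linarith) (by linarith))

lemma lt_UB (hq : 0 < q) (hq1 : q < 1) {r : ℝ} (hr : 0 < r)
    (h : Tendsto (fun n : ℕ => Real.log (avoidSum q n) / n) atTop (𝓝 (Real.log r))) :
    (1 - q) * r < UB q := by
  have hd : 0 < 1 - q := sub_pos.2 hq1
  have ha := four_mul_lt_one hq hq1
  set m := q ^ 2 * (q ^ 2 + 1) with hm
  have hm0 : 0 < m := by positivity
  set E := 1 - 4 * (1 - q) * q ^ 2 * (q ^ 2 + 1) with hE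
  have hEm : E = 1 - 4 * (1 - q) * m := by rw [hE, hm]; ring
  have hE0 : 0 < E := by rw [hE]; linarith
  have hs0 : 0 < √E := Real.sqrt_pos.2 hE0
  have hs1 : √E < 1 := by
    rw [Real.sqrt_lt' one_pos, hEm]
    have : 0 < (1 - q) * m := by positivity
    linarith
  have hss := Real.sq_sqrt hE0.le
  set s := √E with hs
  obtain ⟨z, hzdef⟩ : ∃ z, z = (1 - s) / (2 * m) := ⟨_, rfl⟩
  have hz : 0 < z := hzdef ▸ div_pos (sub_pos.2 hs1) (by positivity)
  have hzs : 2 * m * z = 1 - s := by rw [hzdef]; field_simp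
  have hsz : z * (1 + s) = 2 * (1 - q) := by
    rw [hzdef, div_mul_eq_mul_div, div_eq_iff (by positivity)]
    linear_combination -hss + hEm
  have hQ : (1 - q) - z + m * z ^ 2 = 0 := by
    linear_combination (-1 / 2) * hsz + (z / 2) * hzs
  have hz2 : z < 2 * (1 - q) := by nlinarith
  have hv : 2 * m * z < 1 := by linarith
  have hz1 : z < 1 := by
    by_contra! h1
    -- The quadratic decreases up to its vertex 1/(2m) > z, so its value at 1 ≤ z is nonnegative.
    have h2 : 0 ≤ (1 - q) - 1 + m := by nlinarith
    have h3 : q < 1 / 2 := by linarith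
    rw [hm] at h2
    have h4 : q ^ 2 ≤ 1 / 2 * q := by nlinarith
    have h5 : q ^ 2 * q ^ 2 ≤ 1 / 2 * q * (1 / 4) :=
      mul_le_mul h4 (by nlinarith) (by positivity) (by positivity)
    linarith
  have hw : 4 * (q ^ 3 * z) < 1 := by
    have h1 := pow_three_mul_one_sub_lt q
    have h2 := mul_lt_mul_of_pos_left hz2 (show 0 < q ^ 3 by positivity)
    linarith
  have hG := convergent_pos hq hq1 hz hz2 hv hQ
  -- The conditions are open, so they hold at some t > z; r t ≤ 1 then gives the strict r z < 1.
  have hev : ∀ᶠ t in 𝓝 z, t < 1 ∧ 4 * (q ^ 3 * t) < 1 ∧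
      0 < (1 - t) * (1 - 3 * (q ^ 3 * t) - q ^ 2 * t * (1 - 2 * (q ^ 3 * t)))
        - q * t * (1 - 3 * (q ^ 3 * t)) := by
    refine (Continuous.tendsto continuous_id z |>.eventually_lt_const hz1).and
      ((Continuous.tendsto ?_ z |>.eventually_lt_const hw).and
        (Continuous.tendsto ?_ z |>.eventually_const_lt hG)) <;> fun_prop
  obtain ⟨t, ⟨ht1, htw, htG⟩, hzt⟩ :=
    ((hev.filter_mono nhdsWithin_le_nhds).and (self_mem_nhdsWithin (s := Set.Ioi z))).exists
  have hzt' : z < t := hzt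
  have hrt := growth_mul_le_one_of_convergent hq hq1 hr h (hz.trans hzt') ht1 htw htG
  have hrz : r * z < 1 := (mul_lt_mul_of_pos_left hzt' hr).trans_le hrt
  rw [UB, ← hE, ← hs, lt_div_iff₀ (sub_pos.2 hs1), ← hzs]
  have : (1 - q) * r * (2 * m * z) < 2 * m * (1 - q) := by
    have := mul_lt_mul_of_pos_left hrz (show 0 < 2 * m * (1 - q) by positivity)
    linarith
  rw [hm] at this ⊢
  linarith

end Mallows

theorem theorem4 (q : ℝ) (hq : q ∈ Set.Ioo (0 : ℝ) 1)
    (τ : Equiv.Perm (Fin 3)) (hτ : τ = Mallows.p312 ∨ τ = Mallows.p231) :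
    ∃ L : ℝ,
      Tendsto (fun n : ℕ => (Mallows.prob n q (Mallows.avoiding n τ)) ^ (1 / (n : ℝ)))
        atTop (𝓝 L) ∧
      Mallows.LB q < L ∧ L < Mallows.UB q := by
  obtain ⟨hq0, hq1⟩ := hq
  obtain ⟨r, hr, hlim, hle⟩ := Mallows.exists_growth hq0.le hq1.le
  have h := Mallows.tendsto_prob_avoiding_p231 hq0 hq1 hr hlim
  refine ⟨(1 - q) * r, ?_, Mallows.LB_lt hq0 hq1 hr hle, Mallows.lt_UB hq0 hq1 hr hlim⟩
  rcases hτ with rfl | rfl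
  · simpa only [Mallows.p312_eq, Mallows.prob_avoiding_inv] using h
  · exact h
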